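/- **Setting.** Let $\Omega\subset\mathbb R^d$ be a bounded Lipschitz domain and $0<r<1$. Let $D:\mathbb R^d\to\mathbb R^{d\times d}$ be such that $D(x)$ is invertible for all $x\in\mathbb R^d$, $D$ and $D^{-1}$ (with $D^{-1}(x)=D(x)^{-1}$) are Lipschitz continuous on $\mathbb R^d$, and $0<D_1\le|\det D(x)|\le D_2<\infty$ for all $x\in\overline\Omega$. Write $D_x=D(x)$, $Y=[0,1]^d$ and $Y_x=D_xY$. To a function $\psi(x,y)$ associate $\tilde\psi(x,\tilde y)=\psi(x,D_x\tilde y)$, so that $\psi(x,y)=\tilde\psi(x,D_x^{-1}y)$. Let $C_{\rm per}(Y)$ be the space of continuous $\mathbb Z^d$-periodic real functions on $\mathbb R^d$ with the sup norm; $\psi\in L^2(\Omega;C_{\rm per}(Y_x))$ means $\tilde\psi\in L^2(\Omega;C_{\rm per}(Y))$, and $u\in L^2(\Omega;L^2(Y_x))$ means $\tilde u\in L^2(\Omega;L^2(Y))=L^2(\Omega\times Y)$. **Locally-periodic approximation.** For $\varepsilon>0$ let a partition covering of $\Omega$ be given: finitely many pairwise disjoint open cubes $\Omega_n^\varepsilon$,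 $1\le n\le N_\varepsilon$, of side $\varepsilon^r$, with $\Omega_n^\varepsilon\cap\Omega\ne\emptyset$ and $\Omega\subset\bigcup_n\overline{\Omega_n^\varepsilon}$, together with arbitrary points $x_n^\varepsilon\in\Omega_n^\varepsilon\cap\Omega$ and $\tilde x_n^\varepsilon\in\mathbb R^d$ (for instance $\tilde x_n^\varepsilon\in\Omega_n^\varepsilon\cap\Omega$, or $\tilde x_n^\varepsilon\in\varepsilon D_{x_n^\varepsilon}\mathbb Z^d$). For $\psi\in L^2(\Omega;C_{\rm per}(Y_x))$ put $$(\mathcal L^\varepsilon\psi)(x)=\sum_{n=1}^{N_\varepsilon}\tilde\psi\Big(x,\frac{D^{-1}_{x_n^\varepsilon}(x-\tilde x_n^\varepsilon)}{\varepsilon}\Big)\chi_{\Omega_n^\varepsilon}(x),\qquad x\in\Omega .$$ **Convergence.** Let $\varepsilon_j>0$, $\varepsilon_j\to0$, with a covering and points as above fixed for each $j$ (denote the resulting approximation by $\mathcal L^{\varepsilon_j}$). A sequence $v_j\in L^2(\Omega)$ converges locally-periodic two-scale to $u\in L^2(\Omega;L^2(Y_x))$ if for every $\psi\in L^2(\Omega;C_{\rm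 per}(Y_x))$ $$\lim_{j\to\infty}\int_\Omega v_j(x)\,(\mathcal L^{\varepsilon_j}\psi)(x)\,dx=\int_\Omega\frac1{|Y_x|}\int_{Y_x}u(x,y)\,\psi(x,y)\,dy\,dx .$$ **Theorem 3.2.** Let $\varepsilon_j>0$ with $\varepsilon_j\to0$, let a covering and points as above be fixed for each $j$, and let $(u^{\varepsilon_j})_{j\in\mathbb N}$ be a bounded sequence in $L^2(\Omega)$. Then there exist a subsequence $(u^{\varepsilon_{j_k}})_{k\in\mathbb N}$, with $j_1<j_2<\cdots$, and a function $u\in L^2(\Omega;L^2(Y_x))$ such that $u^{\varepsilon_{j_k}}\to u$ locally-periodic two-scale as $k\to\infty$ (with respect to $\varepsilon_{j_k}$ and the coverings and points fixed for $j_k$). -/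

import Mathlib

open MeasureTheory Filter Topology
open scoped ENNReal

noncomputable section

namespace LocallyPeriodic

/-- The Euclidean space `ℝ^d`. -/
abbrev E (d : ℕ) : Type := EuclideanSpace ℝ (Fin d)

/-- A bounded Lipschitz domain of `ℝ^d`: a bounded, open, connected, non-empty set which, near each
of its boundary points, is the part of a ball lying strictly above the graph (in some direction `e`)
of a Lipschitz function of the variables orthogonal to `e`. -/
structure IsBoundedLipschitzDomain {d : ℕ} (Ω : Set (E d)) : Prop where
  isOpen : IsOpen Ω
  isConnected : IsConnected Ω
  isBounded : Bornology.IsBounded Ω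
  lipschitz_boundary : ∀ p ∈ frontier Ω, ∃ (e : E d) (ρ : ℝ) (K : NNReal) (γ : E d → ℝ),
    ‖e‖ = 1 ∧ 0 < ρ ∧ LipschitzWith K γ ∧ (∀ (x : E d) (t : ℝ), γ (x + t • e) = γ x) ∧
    Ω ∩ Metric.ball p ρ = {x | γ x < inner ℝ x e} ∩ Metric.ball p ρ

/-- The action of a `d × d` matrix on `ℝ^d`, as a continuous linear map; `ℝ^{d × d}` is given the
corresponding operator norm. -/
abbrev act {d : ℕ} (A : Matrix (Fin d) (Fin d) ℝ) : E d →L[ℝ] E d :=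
  Matrix.toEuclideanCLM (𝕜 := ℝ) A

/-- The assumptions on the transformation matrix `D`: `D(x)` is invertible for every `x ∈ ℝ^d`,
`D` and `D⁻¹` are Lipschitz on `ℝ^d`, and `0 < D₁ ≤ |det D(x)| ≤ D₂` on the closure of `Ω`. -/
structure IsTransformation {d : ℕ} (Ω : Set (E d)) (D : E d → Matrix (Fin d) (Fin d) ℝ) :
    Prop where
  isUnit_det : ∀ x, IsUnit (D x).det
  lipschitz : ∃ K : NNReal, LipschitzWith K fun x => act (D x)
  lipschitz_inv : ∃ K : NNReal, LipschitzWith K fun x => act (D x)⁻¹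
  det_bounds : ∃ D₁ D₂ : ℝ, 0 < D₁ ∧ ∀ x ∈ closure Ω, D₁ ≤ |(D x).det| ∧ |(D x).det| ≤ D₂

/-- The unit cell `Y = [0,1]^d`. -/
def unitCell (d : ℕ) : Set (E d) := {y | ∀ i, y i ∈ Set.Icc (0 : ℝ) 1}

/-- The parallelepiped `Y_x = D_x Y`. -/
def cell {d : ℕ} (D : E d → Matrix (Fin d) (Fin d) ℝ) (x : E d) : Set (E d) :=
  act (D x) '' unitCell d

/-- The function `ψ̃(x, ỹ) = ψ(x, D_x ỹ)` that corresponds to `ψ`; equivalently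
`ψ(x, y) = ψ̃(x, D_x⁻¹ y)`. -/
def pullback {d : ℕ} (D : E d → Matrix (Fin d) (Fin d) ℝ) (ψ : E d → E d → ℝ) (x y : E d) : ℝ :=
  ψ x (act (D x) y)

/-- The projection of `ℝ^d` onto the torus `ℝ^d / ℤ^d`. The continuous `Y`-periodic functions on
`ℝ^d` are the functions `g ∘ toTorus` with `g` continuous on the torus, and the sup norms agree. -/
def toTorus {d : ℕ} (y : E d) : UnitAddTorus (Fin d) := fun i => (y i : UnitAddCircle)

/-- `ψ ∈ L²(Ω; C_per(Y_x))`: the corresponding `ψ̃` belongs to the Bochner space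
`L²(Ω; C_per(Y))`, where `C_per(Y)` carries the sup norm. -/
def MemL2Cper {d : ℕ} (Ω : Set (E d)) (D : E d → Matrix (Fin d) (Fin d) ℝ)
    (ψ : E d → E d → ℝ) : Prop :=
  ∃ f : E d → C(UnitAddTorus (Fin d), ℝ), MemLp f 2 (volume.restrict Ω) ∧
    ∀ᵐ x ∂(volume.restrict Ω), ∀ y, pullback D ψ x y = f x (toTorus y)

/-- `u ∈ L²(Ω; L²(Y_x))`: the corresponding `ũ` belongs to `L²(Ω; L²(Y)) = L²(Ω × Y)`. -/
def MemL2L2 {d : ℕ} (Ω : Set (E d)) (D : E d → Matrix (Fin d) (Fin d) ℝ)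
    (u : E d → E d → ℝ) : Prop :=
  MemLp (fun p : E d × E d => pullback D u p.1 p.2) 2
    ((volume.restrict Ω).prod (volume.restrict (unitCell d)))

/-- The open cube of side `s` with vertex `c`; the isometry `R` takes its edges to the coordinate
directions. -/
def openCube {d : ℕ} (c : E d) (R : E d ≃ₗᵢ[ℝ] E d) (s : ℝ) : Set (E d) :=
  {x | ∀ i, R (x - c) i ∈ Set.Ioo (0 : ℝ) s}

/-- A partition covering of `Ω`: finitely many pairwise disjoint open cubes of side `s`, each of
which meets `Ω`, whose closures cover `Ω`, together with the two families of points `x_n` and `x̃_n`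
used in the locally-periodic approximation. The points `x_n` are arbitrary points of the `n`-th cube
in `Ω`. The points `x̃_n`, which only fix a phase, are left free: this comprises both the choice of
points of the `n`-th cube in `Ω` and the choice of points of the lattice `ε D_{x_n} ℤ^d`. -/
structure CubeCovering {d : ℕ} (Ω : Set (E d)) (s : ℝ) where
  N : ℕ
  vertex : Fin N → E d
  frame : Fin N → (E d ≃ₗᵢ[ℝ] E d)
  disjoint : Pairwise fun m n =>
    Disjoint (openCube (vertex m) (frame m) s) (openCube (vertex n) (frame n) s)
  meets : ∀ n, (openCube (vertex n) (frame n) s ∩ Ω).Nonempty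
  covers : Ω ⊆ ⋃ n, closure (openCube (vertex n) (frame n) s)
  pt : Fin N → E d
  pt_mem : ∀ n, pt n ∈ openCube (vertex n) (frame n) s ∩ Ω
  shift : Fin N → E d

/-- The `n`-th cube `Ω_n` of a covering. -/
def CubeCovering.cube {d : ℕ} {Ω : Set (E d)} {s : ℝ} (P : CubeCovering Ω s) (n : Fin P.N) :
    Set (E d) :=
  openCube (P.vertex n) (P.frame n) s

/-- The locally-periodic approximation
`(𝓛^ε ψ)(x) = ∑_n ψ̃(x, D_{x_n}⁻¹ (x - x̃_n) / ε) χ_{Ω_n}(x)`. -/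
def locPerApprox {d : ℕ} {Ω : Set (E d)} (D : E d → Matrix (Fin d) (Fin d) ℝ) (ε : ℝ) {s : ℝ}
    (P : CubeCovering Ω s) (ψ : E d → E d → ℝ) (x : E d) : ℝ :=
  ∑ n, (P.cube n).indicator
    (fun z => pullback D ψ z (ε⁻¹ • act (D (P.pt n))⁻¹ (z - P.shift n))) x

/-- Locally-periodic two-scale convergence of `v j` to `u` as `j → ∞`, where `v j` belongs to the
parameter `ε j` and to the covering `P j` by cubes of side `(ε j)^r`. -/
def LtsConverges {d : ℕ} (Ω : Set (E d)) (D : E d → Matrix (Fin d) (Fin d) ℝ) (r : ℝ)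
    (ε : ℕ → ℝ) (P : ∀ j, CubeCovering Ω (ε j ^ r)) (v : ℕ → E d → ℝ) (u : E d → E d → ℝ) :
    Prop :=
  ∀ ψ : E d → E d → ℝ, MemL2Cper Ω D ψ →
    Tendsto (fun j => ∫ x in Ω, v j x * locPerApprox D (ε j) (P j) ψ x) atTop
      (𝓝 (∫ x in Ω, ⨍ y in cell D x, u x y * ψ x y))

end LocallyPeriodic

end

/-!
Put `X = L²(Ω; C(𝕋))`, where `𝕋 = ℝ^d / ℤ^d`. The approximation is an operator `approxCLM : X →
L²(Ω)` of norm at most one, so `F_j f = ⟪v_j, 𝓛^{ε_j} f⟫` is a bounded sequence of functionals on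
the separable space `X`, and sequential Banach-Alaoglu gives a subsequence that converges
pointwise to some `F`. It remains to represent `F` by a function on `Ω × Y`. Let `J = cellCLM : X
→ L²(Ω × Y)` be the inclusion. If `|F f| ≤ C ‖J f‖`, then `F` factors through `J`, and the
theorems of Hahn-Banach and Riesz produce `w ∈ L²(Ω × Y)` with `F f = ⟪w, J f⟫`
(`exists_eq_inner_of_le`). The limit is `u(x, y) = w(x, D_x⁻¹ y)`; a linear change of variables
turns `⟪w, J f⟫` into an integral of averages over the cells `Y_x` (`inner_cellCLM_eq`).

The estimate `|F f| ≤ C ‖J f‖` (`abs_le_of_tendsto_inner_approxCLM`) amounts to `limsup ‖𝓛^{ε_j}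
f‖ ≤ ‖J f‖`, and it suffices to have this on a dense set, namely for `f` continuous on `ℝ^d` and
zero off `Ω`, which makes the boundary of `Ω` harmless. In one cube the phase is affine, and
moving `x` by `ε D_{x_n} t` moves the phase by `t`. Averaging the integral of `|𝓛^ε f|²` over the
translates with `t ∈ Y` replaces `|f(x, ·)|²` by its mean over the torus, at the price of the
modulus of continuity of `f` and of enlarging the cube by a layer of width `O(ε)`
(`setLIntegral_oscillating_le`). The layers are a fraction `O(ε^{1-r})` of the volume of the
cubes, so both errors vanish in the limit (`eventually_lintegral_cubeEval_sq_le`).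
-/

namespace LocallyPeriodic

variable {d : ℕ} {Ω : Set (E d)} {s : ℝ}

/-! ### The unit cell, the torus and cubes -/

instance isProbabilityMeasure_torus :
    IsProbabilityMeasure (volume : Measure (UnitAddTorus (Fin d))) := by
  constructor
  rw [volume_pi, ← Set.pi_univ Set.univ, Measure.pi_pi]
  simp

lemma continuous_toTorus : Continuous (toTorus (d := d)) :=
  continuous_pi fun i => (AddCircle.continuous_mk' 1).comp (by fun_prop)

lemma measurePreserving_toTorus :
    MeasurePreserving (toTorus (d := d)) (volume.restrict (unitCell d)) volume := by
  have h1 : MeasurePreserving (WithLp.ofLp : E d → Fin d → ℝ) (volume.restrict (unitCell d))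
      (volume.restrict (Set.univ.pi fun _ => Set.Icc (0 : ℝ) 1)) := by
    have := (PiLp.volume_preserving_ofLp (Fin d)).restrict_preimage
      (s := Set.univ.pi fun _ => Set.Icc (0 : ℝ) 1)
      (MeasurableSet.univ_pi fun _ => measurableSet_Icc)
    have hY : unitCell d = (WithLp.ofLp : E d → Fin d → ℝ) ⁻¹'
        (Set.univ.pi fun _ => Set.Icc (0 : ℝ) 1) := by
      ext y; simp only [unitCell, Set.mem_preimage, Set.mem_univ_pi]; rfl
    rw [hY]
    exact this
  have h2 : MeasurePreserving (fun (y : Fin d → ℝ) i => (y i : UnitAddCircle))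
      (volume.restrict (Set.univ.pi fun _ => Set.Icc (0 : ℝ) 1)) volume := by
    rw [volume_pi, volume_pi, Measure.restrict_pi_pi]
    refine measurePreserving_pi _ _ fun i => ?_
    have := UnitAddCircle.measurePreserving_mk 0
    rwa [zero_add, Measure.restrict_congr_set Ioc_ae_eq_Icc] at this
  exact h2.comp h1

instance isProbabilityMeasure_unitCell :
    IsProbabilityMeasure (volume.restrict (unitCell d)) := by
  have h := (measurePreserving_toTorus (d := d)).measure_preimage
    MeasurableSet.univ.nullMeasurableSet
  exact ⟨by simpa using h⟩

lemma toTorus_add (x y : E d) : toTorus (x + y) = toTorus x + toTorus y := by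
  ext i; simp [toTorus]

lemma isClosed_unitCell : IsClosed (unitCell d) := by
  simp only [unitCell, Set.ofPred_forall]
  exact isClosed_iInter fun i => isClosed_Icc.preimage (by fun_prop)

lemma norm_le_of_mem_unitCell {y : E d} (hy : y ∈ unitCell d) : ‖y‖ ≤ Real.sqrt d := by
  rw [EuclideanSpace.norm_eq]
  refine Real.sqrt_le_sqrt ?_
  calc ∑ i, ‖y i‖ ^ 2 ≤ ∑ _i : Fin d, (1 : ℝ) := by
        refine Finset.sum_le_sum fun i _ => ?_
        have := hy i
        rw [Real.norm_of_nonneg this.1]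
        exact pow_le_one₀ this.1 this.2
    _ = d := by simp

/-- The open cube with edges `(a, b)` in the frame `R` with origin `c`. -/
def box (c : E d) (R : E d ≃ₗᵢ[ℝ] E d) (a b : ℝ) : Set (E d) :=
  {x | ∀ i, R (x - c) i ∈ Set.Ioo a b}

lemma isOpen_box (c : E d) (R : E d ≃ₗᵢ[ℝ] E d) (a b : ℝ) : IsOpen (box c R a b) := by
  simp only [box, Set.ofPred_forall]
  exact isOpen_iInter_of_finite fun i => isOpen_Ioo.preimage (by fun_prop)

lemma volume_box (c : E d) (R : E d ≃ₗᵢ[ℝ] E d) (a b : ℝ) :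
    volume (box c R a b) = ENNReal.ofReal (b - a) ^ d := by
  have h : MeasurePreserving (fun x : E d => WithLp.ofLp (R (x - c))) volume volume :=
    (PiLp.volume_preserving_ofLp (Fin d)).comp
      (R.measurePreserving.comp (measurePreserving_sub_right volume c))
  have hb : box c R a b =
      (fun x : E d => WithLp.ofLp (R (x - c))) ⁻¹' (Set.univ.pi fun _ => Set.Ioo a b) := by
    ext; simp [box, Set.mem_pi]
  rw [hb, h.measure_preimage (MeasurableSet.univ_pi fun _ => measurableSet_Ioo).nullMeasurableSet,
    Real.volume_pi_Ioo]
  simp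

/-- A mean-value inequality for oscillating integrals: up to the enlargement `Q'` of `Q` and the
modulus of continuity `η` of `q`, the oscillating argument of `q` may be replaced by the mean over
the torus. The integral is averaged over the translations by `ε A t`, `t ∈ Y`, which leave Lebesgue
measure invariant and move the argument by `t`. -/
lemma setLIntegral_oscillating_le {Q Q' : Set (E d)} (hQ : MeasurableSet Q)
    (hQ' : MeasurableSet Q') (A B : E d →L[ℝ] E d) (hBA : ∀ t, B (A t) = t) {ε : ℝ} (hε : 0 < ε)
    (c : E d) (hsub : ∀ t ∈ unitCell d, ∀ z, z + ε • A t ∈ Q → z ∈ Q')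
    {q : E d → UnitAddTorus (Fin d) → ℝ≥0∞} (hq : Measurable (Function.uncurry q)) {η : ℝ≥0∞}
    (hmod : ∀ t ∈ unitCell d, ∀ z y, q (z + ε • A t) y ≤ q z y + η) :
    ∫⁻ x in Q, q x (toTorus (ε⁻¹ • B (x - c))) ≤ ∫⁻ z in Q', ((∫⁻ y, q z y) + η) := by
  set θ : E d → UnitAddTorus (Fin d) := fun x => toTorus (ε⁻¹ • B (x - c)) with hθ
  have hθc : Continuous θ := continuous_toTorus.comp (by fun_prop)
  have hshift : ∀ z t, θ (z + ε • A t) = θ z + toTorus t := by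
    intro z t
    rw [hθ]
    simp only
    rw [← toTorus_add]
    congr 1
    rw [add_sub_right_comm, map_add, map_smul, hBA, smul_add, smul_smul,
      inv_mul_cancel₀ hε.ne', one_smul]
  have hmeas : Measurable fun p : E d × E d => q p.2 (θ p.2 + toTorus p.1) + η := by
    have : Measurable fun p : E d × E d => (p.2, θ p.2 + toTorus p.1) :=
      (continuous_snd.prodMk ((hθc.comp continuous_snd).add
        (continuous_toTorus.comp continuous_fst))).measurable
    exact (hq.comp this).add_const η
  calc ∫⁻ x in Q, q x (θ x)
      = ∫⁻ _t in unitCell d, ∫⁻ x in Q, q x (θ x) := by simp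
    _ = ∫⁻ t in unitCell d, ∫⁻ z, Q.indicator (fun x => q x (θ x)) (z + ε • A t) := by
        refine lintegral_congr fun t => ?_
        rw [lintegral_add_right_eq_self (fun x => Q.indicator (fun x => q x (θ x)) x),
          lintegral_indicator hQ]
    _ ≤ ∫⁻ t in unitCell d, ∫⁻ z in Q', (q z (θ z + toTorus t) + η) := by
        refine setLIntegral_mono' isClosed_unitCell.measurableSet fun t ht => ?_
        rw [← lintegral_indicator hQ']
        refine lintegral_mono fun z => ?_
        by_cases hz : z + ε • A t ∈ Q
        · rw [Set.indicator_of_mem hz, Set.indicator_of_mem (hsub t ht z hz), hshift]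
          exact hmod t ht z _
        · rw [Set.indicator_of_notMem hz]; exact zero_le
    _ = ∫⁻ z in Q', ∫⁻ t in unitCell d, (q z (θ z + toTorus t) + η) :=
        lintegral_lintegral_swap hmeas.aemeasurable
    -- by translation invariance on the torus the phase `θ z` drops out of the mean over `t`
    _ = ∫⁻ z in Q', ((∫⁻ y, q z y) + η) := by
        refine lintegral_congr fun z => ?_
        have hqz : Measurable (q z) := hq.comp measurable_prodMk_left
        rw [lintegral_add_right _ measurable_const]
        have := (measurePreserving_toTorus (d := d)).lintegral_comp
          (f := fun y => q z (θ z + y)) (hqz.comp (measurable_const_add _))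
        rw [this, lintegral_add_left_eq_self (fun y => q z y)]
        simp

/-! ### Sampling operators -/

section Sampling

variable {V α β : Type*} [NormedAddCommGroup V] [NormedSpace ℝ V] [MeasurableSpace α]
  [MeasurableSpace β] {μ : Measure α} {ν : Measure β} {π : β → α} {ℓ : β → V →L[ℝ] ℝ}

lemma memLp_sample (hπ : MeasurePreserving π ν μ) (hℓ : ∀ p, ‖ℓ p‖ ≤ 1)
    (hmeas : ∀ f : α → V, StronglyMeasurable f → AEStronglyMeasurable (fun p => ℓ p (f (π p))) ν)
    {f : α → V} (hf : MemLp f 2 μ) : MemLp (fun p => ℓ p (f (π p))) 2 ν := by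
  refine (hf.comp_measurePreserving hπ).mono ?_ (ae_of_all _ fun p => ?_)
  · refine (hmeas _ hf.1.stronglyMeasurable_mk).congr ?_
    have := hπ.quasiMeasurePreserving.ae_eq_comp hf.1.ae_eq_mk
    filter_upwards [this] with p hp
    simp only [Function.comp_apply] at hp
    rw [hp]
  · simpa using (ℓ p).le_of_opNorm_le (hℓ p) (f (π p))

/-- The operator `f ↦ (p ↦ ℓ p (f (π p)))` from `L²(μ; V)` to `L²(ν)`, for a measure preserving map
`π` and a family `ℓ` of functionals of norm at most one. -/
noncomputable def sampleCLM (hπ : MeasurePreserving π ν μ) (hℓ : ∀ p, ‖ℓ p‖ ≤ 1)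
    (hmeas : ∀ f : α → V, StronglyMeasurable f →
      AEStronglyMeasurable (fun p => ℓ p (f (π p))) ν) :
    Lp V 2 μ →L[ℝ] Lp ℝ 2 ν :=
  LinearMap.mkContinuous
    { toFun := fun f => (memLp_sample hπ hℓ hmeas (Lp.memLp f)).toLp _
      map_add' := fun f g => by
        rw [← MemLp.toLp_add]
        refine MemLp.toLp_congr _ _ ?_
        filter_upwards [hπ.quasiMeasurePreserving.ae (Lp.coeFn_add f g)] with p hp
        exact (congrArg (ℓ p) hp).trans (map_add (ℓ p) _ _)
      map_smul' := fun c f => by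
        rw [RingHom.id_apply, ← MemLp.toLp_const_smul]
        refine MemLp.toLp_congr _ _ ?_
        filter_upwards [hπ.quasiMeasurePreserving.ae (Lp.coeFn_smul c f)] with p hp
        exact (congrArg (ℓ p) hp).trans (map_smul (ℓ p) _ _) }
    1 fun f => by
      rw [one_mul]
      change ‖(memLp_sample hπ hℓ hmeas (Lp.memLp f)).toLp _‖ ≤ ‖f‖
      rw [Lp.norm_toLp, Lp.norm_def]
      refine ENNReal.toReal_mono (Lp.eLpNorm_ne_top f) ?_
      rw [← eLpNorm_comp_measurePreserving (Lp.aestronglyMeasurable f) hπ]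
      refine eLpNorm_mono fun p => ?_
      simpa using (ℓ p).le_of_opNorm_le (hℓ p) (f (π p))

lemma norm_sampleCLM_le (hπ : MeasurePreserving π ν μ) (hℓ : ∀ p, ‖ℓ p‖ ≤ 1)
    (hmeas : ∀ f : α → V, StronglyMeasurable f →
      AEStronglyMeasurable (fun p => ℓ p (f (π p))) ν) :
    ‖sampleCLM hπ hℓ hmeas‖ ≤ 1 :=
  LinearMap.mkContinuous_norm_le _ zero_le_one _

lemma sampleCLM_toLp (hπ : MeasurePreserving π ν μ) (hℓ : ∀ p, ‖ℓ p‖ ≤ 1)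
    (hmeas : ∀ f : α → V, StronglyMeasurable f →
      AEStronglyMeasurable (fun p => ℓ p (f (π p))) ν) {f : α → V} (hf : MemLp f 2 μ) :
    sampleCLM hπ hℓ hmeas (hf.toLp f) =ᵐ[ν] fun p => ℓ p (f (π p)) := by
  refine (MemLp.coeFn_toLp (memLp_sample hπ hℓ hmeas (Lp.memLp (hf.toLp f)))).trans ?_
  filter_upwards [hπ.quasiMeasurePreserving.ae hf.coeFn_toLp] with p hp
  rw [hp]

end Sampling

lemma norm_evalCLM_le {K : Type*} [TopologicalSpace K] [CompactSpace K] (x : K) :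
    ‖(ContinuousMap.evalCLM ℝ x : C(K, ℝ) →L[ℝ] ℝ)‖ ≤ 1 :=
  ContinuousLinearMap.opNorm_le_bound _ zero_le_one fun f => by
    simpa using f.norm_coe_le_norm x

lemma stronglyMeasurable_eval {α K : Type*} [MeasurableSpace α] [TopologicalSpace K]
    [CompactSpace K] {f : α → C(K, ℝ)}
    (hf : StronglyMeasurable f) {θ : α → K} (hθ : StronglyMeasurable θ) :
    StronglyMeasurable fun x => f x (θ x) :=
  continuous_eval.comp_stronglyMeasurable (hf.prodMk hθ)

/-- The phase `D_{x_n}⁻¹ (x - x̃_n) / ε` seen on the torus. -/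
noncomputable def phase (D : E d → Matrix (Fin d) (Fin d) ℝ) (ε : ℝ) (P : CubeCovering Ω s)
    (n : Fin P.N) (x : E d) : UnitAddTorus (Fin d) :=
  toTorus (ε⁻¹ • act (D (P.pt n))⁻¹ (x - P.shift n))

lemma continuous_phase (D : E d → Matrix (Fin d) (Fin d) ℝ) (ε : ℝ) (P : CubeCovering Ω s)
    (n : Fin P.N) : Continuous (phase D ε P n) :=
  continuous_toTorus.comp (by fun_prop)

/-- The functional `g ↦ ∑_n g(phase_n(x)) χ_{Ω_n}(x)` on `C(ℝ^d / ℤ^d)`. -/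
noncomputable def cubeEval (D : E d → Matrix (Fin d) (Fin d) ℝ) (ε : ℝ) (P : CubeCovering Ω s)
    (x : E d) : C(UnitAddTorus (Fin d), ℝ) →L[ℝ] ℝ :=
  ∑ n, (P.cube n).indicator (fun z => ContinuousMap.evalCLM ℝ (phase D ε P n z)) x

lemma isOpen_cube (P : CubeCovering Ω s) (n : Fin P.N) : IsOpen (P.cube n) :=
  isOpen_box _ _ _ _

lemma cubeEval_of_mem (D : E d → Matrix (Fin d) (Fin d) ℝ) (ε : ℝ) (P : CubeCovering Ω s)
    {n : Fin P.N} {x : E d} (hx : x ∈ P.cube n) :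
    cubeEval D ε P x = ContinuousMap.evalCLM ℝ (phase D ε P n x) := by
  rw [cubeEval, Finset.sum_eq_single n, Set.indicator_of_mem hx]
  · intro m _ hm
    exact Set.indicator_of_notMem (fun h => Set.disjoint_left.mp (P.disjoint hm) h hx) _
  · simp

lemma cubeEval_of_notMem (D : E d → Matrix (Fin d) (Fin d) ℝ) (ε : ℝ) (P : CubeCovering Ω s)
    {x : E d} (hx : ∀ n, x ∉ P.cube n) : cubeEval D ε P x = 0 :=
  Finset.sum_eq_zero fun n _ => Set.indicator_of_notMem (hx n) _

lemma norm_cubeEval_le (D : E d → Matrix (Fin d) (Fin d) ℝ) (ε : ℝ) (P : CubeCovering Ω s)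
    (x : E d) : ‖cubeEval D ε P x‖ ≤ 1 := by
  by_cases hx : ∃ n, x ∈ P.cube n
  · obtain ⟨n, hn⟩ := hx
    rw [cubeEval_of_mem D ε P hn]
    exact norm_evalCLM_le _
  · rw [cubeEval_of_notMem D ε P (not_exists.mp hx)]
    exact ContinuousLinearMap.opNorm_le_bound _ zero_le_one (by simp)

lemma cubeEval_apply (D : E d → Matrix (Fin d) (Fin d) ℝ) (ε : ℝ) (P : CubeCovering Ω s)
    (g : C(UnitAddTorus (Fin d), ℝ)) (x : E d) :
    cubeEval D ε P x g = ∑ n, (P.cube n).indicator (fun z => g (phase D ε P n z)) x := by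
  rw [cubeEval, sum_apply]
  refine Finset.sum_congr rfl fun n _ => ?_
  by_cases hx : x ∈ P.cube n <;> simp [hx]

lemma stronglyMeasurable_cubeEval (D : E d → Matrix (Fin d) (Fin d) ℝ) (ε : ℝ)
    (P : CubeCovering Ω s) {f : E d → C(UnitAddTorus (Fin d), ℝ)} (hf : StronglyMeasurable f) :
    StronglyMeasurable fun x => cubeEval D ε P x (f x) := by
  simp only [cubeEval, sum_apply]
  refine Finset.stronglyMeasurable_fun_sum _ fun n _ => ?_
  have : (fun x => (P.cube n).indicator (fun z => (ContinuousMap.evalCLM ℝ (phase D ε P n z) :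
      C(UnitAddTorus (Fin d), ℝ) →L[ℝ] ℝ)) x (f x)) =
      (P.cube n).indicator fun x => f x (phase D ε P n x) := by
    ext x
    by_cases hx : x ∈ P.cube n <;> simp [hx]
  rw [this]
  exact (stronglyMeasurable_eval hf (continuous_phase D ε P n).stronglyMeasurable).indicator
    (isOpen_cube P n).measurableSet

/-- The locally-periodic approximation as an operator on `L²(Ω; C_per(Y))`. -/
noncomputable def approxCLM (D : E d → Matrix (Fin d) (Fin d) ℝ) (ε : ℝ) (P : CubeCovering Ω s) :
    Lp C(UnitAddTorus (Fin d), ℝ) 2 (volume.restrict Ω) →L[ℝ] Lp ℝ 2 (volume.restrict Ω) :=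
  sampleCLM (π := id) (ℓ := cubeEval D ε P) (MeasurePreserving.id _) (norm_cubeEval_le D ε P)
    fun _ hf => (stronglyMeasurable_cubeEval D ε P hf).aestronglyMeasurable

/-- The inclusion of `L²(Ω; C_per(Y))` into `L²(Ω × Y)`. -/
noncomputable def cellCLM (Ω : Set (E d)) :
    Lp C(UnitAddTorus (Fin d), ℝ) 2 (volume.restrict Ω) →L[ℝ]
      Lp ℝ 2 ((volume.restrict Ω).prod (volume.restrict (unitCell d))) :=
  sampleCLM (π := Prod.fst) (ℓ := fun p => ContinuousMap.evalCLM ℝ (toTorus p.2))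
    measurePreserving_fst (fun _ => norm_evalCLM_le _)
    fun _ hf => (stronglyMeasurable_eval (hf.comp_measurable measurable_fst)
      (continuous_toTorus.comp continuous_snd).stronglyMeasurable).aestronglyMeasurable

/-! ### The mean-value estimate for the approximation -/

lemma pairwise_disjoint_cube (P : CubeCovering Ω s) : Pairwise (Function.onFun Disjoint P.cube) :=
  P.disjoint

/-- The layer of width `ρ` around a cube of side `s` is a fraction
`(1 + 2ρ/s)^d - 1` of the cube. -/
lemma volume_enlarged_sdiff_le (c : E d) (R : E d ≃ₗᵢ[ℝ] E d) (hs : 0 < s) {ρ : ℝ} (hρ : 0 ≤ ρ) :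
    volume (box c R (-ρ) (s + ρ) \ box c R 0 s) ≤
      ENNReal.ofReal ((1 + 2 * (ρ / s)) ^ d - 1) * volume (box c R 0 s) := by
  have hsub : box c R 0 s ⊆ box c R (-ρ) (s + ρ) := fun x hx i =>
    ⟨by linarith [(hx i).1], by linarith [(hx i).2]⟩
  have h1 : (1 : ℝ) ≤ (1 + 2 * (ρ / s)) ^ d := one_le_pow₀ (by
    have := div_nonneg hρ hs.le
    linarith)
  rw [measure_sdiff hsub (isOpen_box _ _ _ _).measurableSet.nullMeasurableSet (by
    rw [volume_box]; finiteness), volume_box, volume_box, tsub_le_iff_right, sub_zero,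
    ← ENNReal.ofReal_pow (by linarith), ← ENNReal.ofReal_pow hs.le,
    ← ENNReal.ofReal_mul (by linarith), ← ENNReal.ofReal_add (by
      have := pow_pos hs d
      exact mul_nonneg (by linarith) this.le) (pow_pos hs d).le]
  refine ENNReal.ofReal_le_ofReal (le_of_eq ?_)
  have : s + ρ - -ρ = (1 + 2 * (ρ / s)) * s := by field_simp; ring
  rw [this, mul_pow]
  ring

lemma norm_sub_le_of_mem_cube (P : CubeCovering Ω s) {n : Fin P.N} {x y : E d}
    (hx : x ∈ P.cube n) (hy : y ∈ P.cube n) : ‖x - y‖ ≤ s * Real.sqrt d := by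
  -- for `d = 0` the side `s` may be negative
  rcases isEmpty_or_nonempty (Fin d) with h | ⟨⟨i⟩⟩
  · have : x - y = 0 := Subsingleton.elim _ _
    have hd : d = 0 := (Fintype.card_fin d).symm.trans (Fintype.card_eq_zero_iff.mpr h)
    simp [this, hd]
  have hs : 0 ≤ s := ((hx i).1.trans (hx i).2).le
  have hR : ‖x - y‖ = ‖P.frame n (x - P.vertex n) - P.frame n (y - P.vertex n)‖ := by
    rw [← map_sub, LinearIsometryEquiv.norm_map, sub_sub_sub_cancel_right]
  rw [hR, EuclideanSpace.norm_eq]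
  refine Real.sqrt_le_iff.mpr ⟨by positivity, ?_⟩
  rw [mul_pow, Real.sq_sqrt (Nat.cast_nonneg d)]
  calc _ ≤ ∑ _i : Fin d, s ^ 2 := by
        refine Finset.sum_le_sum fun i _ => ?_
        rw [Real.norm_eq_abs, sq_abs, PiLp.sub_apply]
        have h1 := hx i
        have h2 := hy i
        exact sq_le_sq' (by linarith [h1.1, h2.2]) (by linarith [h1.2, h2.1])
    _ = s ^ 2 * d := by simp [mul_comm]

lemma iUnion_cube_subset (P : CubeCovering Ω s) (hs : s ≤ 1) {ϱ : ℝ}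
    (hΩ : Ω ⊆ Metric.closedBall 0 ϱ) :
    (⋃ n, P.cube n) ⊆ Metric.closedBall 0 (ϱ + Real.sqrt d) := by
  refine Set.iUnion_subset fun n x hx => ?_
  obtain ⟨y, hy, hyΩ⟩ := P.meets n
  have h1 := norm_sub_le_of_mem_cube P hx hy
  have h2 := mem_closedBall_zero_iff.mp (hΩ hyΩ)
  rw [mem_closedBall_zero_iff]
  have h3 : s * Real.sqrt d ≤ Real.sqrt d := mul_le_of_le_one_left (Real.sqrt_nonneg _) hs
  have h4 : ‖x‖ ≤ ‖x - y‖ + ‖y‖ := by simpa using norm_add_le (x - y) y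
  linarith

lemma act_inv_act {A : Matrix (Fin d) (Fin d) ℝ} (hA : IsUnit A.det) (t : E d) :
    act A⁻¹ (act A t) = t := by
  rw [← mul_apply_eq_comp, ← map_mul, Matrix.nonsing_inv_mul A hA, map_one]
  rfl

/-- The mean-value inequality summed over the cubes of a covering: the error consists of the modulus
of continuity `η` and of the contribution of the layers around the cubes. -/
lemma sum_setLIntegral_phase_le {D : E d → Matrix (Fin d) (Fin d) ℝ}
    (hD : ∀ x, IsUnit (D x).det) {ε : ℝ} (hε : 0 < ε) (P : CubeCovering Ω s) (hs : 0 < s) {K ρ : ℝ}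
    (hK : ∀ x ∈ Ω, ‖act (D x)‖ ≤ K) (hK0 : 0 ≤ K) (hρ : ρ = ε * (K * Real.sqrt d))
    {q : E d → UnitAddTorus (Fin d) → ℝ≥0∞}
    (hq : Measurable (Function.uncurry q)) {η M V : ℝ≥0∞}
    (hmod : ∀ z h : E d, ‖h‖ ≤ ρ → ∀ y, q (z + h) y ≤ q z y + η) (hM : ∀ z y, q z y ≤ M)
    (hV : volume (⋃ n, P.cube n) ≤ V) :
    ∑ n, ∫⁻ x in P.cube n, q x (phase D ε P n x) ≤
      (∫⁻ x, ∫⁻ y, q x y) + η * V +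
        ENNReal.ofReal ((1 + 2 * (ρ / s)) ^ d - 1) * V * (M + η) := by
  have hρ0 : 0 ≤ ρ := hρ ▸ by positivity
  set κ := ENNReal.ofReal ((1 + 2 * (ρ / s)) ^ d - 1)
  have hcube : ∀ n, MeasurableSet (P.cube n) := fun n => (isOpen_cube P n).measurableSet
  have hsumvol : ∑ n, volume (P.cube n) ≤ V := by
    rw [← tsum_fintype (L := .unconditional _), ← measure_iUnion (pairwise_disjoint_cube P) hcube]
    exact hV
  have hstep : ∀ n, ∫⁻ x in P.cube n, q x (phase D ε P n x) ≤
      (∫⁻ x in P.cube n, ((∫⁻ y, q x y) + η)) + κ * volume (P.cube n) * (M + η) := by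
    intro n
    set Q' := box (P.vertex n) (P.frame n) (-ρ) (s + ρ)
    have hQ' : MeasurableSet Q' := (isOpen_box _ _ _ _).measurableSet
    have hshort : ∀ t ∈ unitCell d, ‖ε • act (D (P.pt n)) t‖ ≤ ρ := by
      intro t ht
      rw [norm_smul, Real.norm_of_nonneg hε.le, hρ]
      refine mul_le_mul_of_nonneg_left ?_ hε.le
      exact ((act (D (P.pt n))).le_opNorm t).trans
        (mul_le_mul (hK _ (P.pt_mem n).2) (norm_le_of_mem_unitCell ht) (norm_nonneg _) hK0)
    have hsub : ∀ t ∈ unitCell d, ∀ z, z + ε • act (D (P.pt n)) t ∈ P.cube n → z ∈ Q' := by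
      intro t ht z hz i
      have h1 := hz i
      rw [add_sub_right_comm, map_add, PiLp.add_apply] at h1
      have h2 := (PiLp.norm_apply_le (P.frame n (ε • act (D (P.pt n)) t)) i).trans
        ((LinearIsometryEquiv.norm_map _ _).trans_le (hshort t ht))
      rw [Real.norm_eq_abs, abs_le] at h2
      exact ⟨by linarith [h1.1], by linarith [h1.2]⟩
    refine (setLIntegral_oscillating_le (hcube n) hQ' (act (D (P.pt n)))
      (act (D (P.pt n))⁻¹) (act_inv_act (hD _)) hε (P.shift n) hsub hq
      fun t ht z y => hmod z _ (hshort t ht) y).trans ?_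
    have hbound : ∀ z, (∫⁻ y, q z y) + η ≤ M + η := fun z => by
      gcongr
      exact (lintegral_mono (hM z)).trans (by simp)
    rw [← lintegral_inter_add_sdiff _ Q' (hcube n)]
    gcongr
    · exact Set.inter_subset_right
    · refine (setLIntegral_mono' (hQ'.diff (hcube n)) fun z _ => hbound z).trans ?_
      rw [setLIntegral_const, mul_comm]
      gcongr
      exact volume_enlarged_sdiff_le _ _ hs hρ0
  calc _ ≤ ∑ n, ((∫⁻ x in P.cube n, ((∫⁻ y, q x y) + η)) + κ * volume (P.cube n) * (M + η)) :=
        Finset.sum_le_sum fun n _ => hstep n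
    _ = (∫⁻ x in ⋃ n, P.cube n, ((∫⁻ y, q x y) + η)) +
          κ * (∑ n, volume (P.cube n)) * (M + η) := by
        rw [Finset.sum_add_distrib, ← Finset.sum_mul, ← Finset.mul_sum,
          lintegral_iUnion hcube (pairwise_disjoint_cube P), tsum_fintype]
    _ ≤ _ := by
        rw [lintegral_add_right _ measurable_const, setLIntegral_const]
        gcongr
        exact Measure.restrict_le_self

lemma enorm_cubeEval_sq (D : E d → Matrix (Fin d) (Fin d) ℝ) (ε : ℝ) (P : CubeCovering Ω s)
    (g : C(UnitAddTorus (Fin d), ℝ)) (x : E d) :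
    ‖cubeEval D ε P x g‖ₑ ^ 2 =
      ∑ n, (P.cube n).indicator (fun z => ‖g (phase D ε P n z)‖ₑ ^ 2) x := by
  by_cases hx : ∃ n, x ∈ P.cube n
  · obtain ⟨n, hn⟩ := hx
    rw [cubeEval_of_mem D ε P hn, Finset.sum_eq_single n, Set.indicator_of_mem hn]
    · rfl
    · intro m _ hm
      exact Set.indicator_of_notMem (fun h => Set.disjoint_left.mp (P.disjoint hm) h hn) _
    · simp
  · rw [cubeEval_of_notMem D ε P (not_exists.mp hx), Finset.sum_eq_zero]
    · simp
    · intro n _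
      exact Set.indicator_of_notMem (not_exists.mp hx n) _

lemma exists_norm_act_le (hΩ : Bornology.IsBounded Ω) {D : E d → Matrix (Fin d) (Fin d) ℝ}
    (hD : IsTransformation Ω D) : ∃ K, 0 ≤ K ∧ ∀ x ∈ Ω, ‖act (D x)‖ ≤ K := by
  obtain ⟨L, hL⟩ := hD.lipschitz
  obtain ⟨K, hK⟩ := (hL.isBounded_image hΩ).exists_norm_le
  exact ⟨max K 0, le_max_right _ _, fun x hx => (hK _ ⟨x, hx, rfl⟩).trans (le_max_left _ _)⟩

/-- `limsup ‖𝓛^ε f‖²` is at most the square of the norm of `f` in `L²(Ω × 𝕋)`, for `f` continuous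
with compact support and zero off `Ω`. As `f` vanishes off `Ω`, the cubes that leave `Ω` do not
contribute to the bound beyond the error. -/
lemma eventually_lintegral_cubeEval_sq_le (hΩ : Bornology.IsBounded Ω)
    {D : E d → Matrix (Fin d) (Fin d) ℝ} (hD : IsTransformation Ω D) {r : ℝ} (hr0 : 0 < r)
    (hr1 : r < 1) {ε : ℕ → ℝ} (hεpos : ∀ j, 0 < ε j) (hε : Tendsto ε atTop (𝓝 0))
    (P : ∀ j, CubeCovering Ω (ε j ^ r)) {f : E d → C(UnitAddTorus (Fin d), ℝ)}
    (hf : Continuous f) (hfc : HasCompactSupport f) (hfΩ : ∀ x ∉ Ω, f x = 0) {δ : ℝ≥0∞}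
    (hδ : δ ≠ 0) :
    ∀ᶠ j in atTop, ∫⁻ x in Ω, ‖cubeEval D (ε j) (P j) x (f x)‖ₑ ^ 2 ≤
      (∫⁻ x in Ω, ∫⁻ y, ‖f x y‖ₑ ^ 2) + δ := by
  obtain ⟨ϱ, hϱ⟩ := hΩ.subset_closedBall 0
  obtain ⟨K, hK0, hK⟩ := exists_norm_act_le hΩ hD
  set V : ℝ≥0∞ := volume (Metric.closedBall (0 : E d) (ϱ + Real.sqrt d))
  have hVtop : V ≠ ∞ := measure_closedBall_lt_top.ne
  set q : E d → UnitAddTorus (Fin d) → ℝ≥0∞ := fun x y => ‖f x y‖ₑ ^ 2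
  have hqc : Continuous (Function.uncurry q) := by
    have : Continuous fun p : E d × UnitAddTorus (Fin d) => f p.1 p.2 :=
      continuous_eval.comp ((hf.comp continuous_fst).prodMk continuous_snd)
    exact (ENNReal.continuous_pow 2).comp this.enorm
  have hqw : ∀ x y, q x y = ENNReal.ofReal ((f x * f x) y) := by
    intro x y
    rw [ContinuousMap.mul_apply, ← abs_mul_abs_self, ENNReal.ofReal_mul (abs_nonneg _), ← sq,
      ← Real.enorm_eq_ofReal_abs]
  obtain ⟨C, hC⟩ := hfc.exists_bound_of_continuous hf
  set M : ℝ≥0∞ := ENNReal.ofReal C ^ 2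
  have hM : ∀ z y, q z y ≤ M := by
    intro z y
    simp only [q, M]
    gcongr
    rw [← ofReal_norm]
    exact ENNReal.ofReal_le_ofReal (((f z).norm_coe_le_norm y).trans (hC z))
  -- the tolerance `η` in the modulus of continuity costs at most `η V ≤ δ / 2`
  obtain ⟨η, hη0, hηV⟩ : ∃ η : ℝ, 0 < η ∧ ENNReal.ofReal η * V ≤ δ / 2 := by
    have h : Tendsto (fun η : ℝ => ENNReal.ofReal η * V) (𝓝[>] 0) (𝓝 0) := by
      have h1 : Tendsto (fun η : ℝ => ENNReal.ofReal η) (𝓝[>] 0) (𝓝 0) := by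
        simpa using (ENNReal.continuous_ofReal.tendsto (0 : ℝ)).mono_left nhdsWithin_le_nhds
      simpa using ENNReal.Tendsto.mul_const h1 (Or.inr hVtop)
    have h2 := h.eventually_le_const (ENNReal.half_pos hδ)
    obtain ⟨η, h3, h4⟩ := (h2.and self_mem_nhdsWithin).exists
    exact ⟨η, h4, h3⟩
  have huc : UniformContinuous fun x => f x * f x :=
    (hfc.mul_left (f' := f)).uniformContinuous_of_continuous (hf.mul hf)
  obtain ⟨τ, hτ0, hτ⟩ := Metric.uniformContinuous_iff.mp huc η hη0
  have hmod : ∀ z h : E d, ‖h‖ < τ → ∀ y, q (z + h) y ≤ q z y + ENNReal.ofReal η := by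
    intro z h hh y
    have h1 : dist (f (z + h) * f (z + h)) (f z * f z) < η := hτ (by simpa using hh)
    have h2 := (ContinuousMap.dist_apply_le_dist y).trans h1.le
    rw [hqw, hqw]
    refine (ENNReal.ofReal_le_ofReal ?_).trans ENNReal.ofReal_add_le
    rw [Real.dist_eq] at h2
    linarith [le_abs_self ((f (z + h) * f (z + h)) y - (f z * f z) y)]
  set ρ : ℕ → ℝ := fun j => ε j * (K * Real.sqrt d) with hρdef
  have hρ : Tendsto ρ atTop (𝓝 0) := by simpa using hε.mul_const (K * Real.sqrt d)
  have hs : Tendsto (fun j => ε j ^ r) atTop (𝓝 0) := by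
    simpa [Real.zero_rpow hr0.ne'] using hε.rpow_const (Or.inr hr0.le)
  have hρs : Tendsto (fun j => ρ j / ε j ^ r) atTop (𝓝 0) := by
    have h1 : Tendsto (fun j => ε j ^ (1 - r)) atTop (𝓝 0) := by
      simpa [Real.zero_rpow (sub_pos.mpr hr1).ne'] using
        hε.rpow_const (p := 1 - r) (Or.inr (sub_pos.mpr hr1).le)
    have h2 := h1.mul_const (K * Real.sqrt d)
    rw [zero_mul] at h2
    refine h2.congr fun j => ?_
    rw [Real.rpow_sub (hεpos j), Real.rpow_one, hρdef]
    ring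
  -- the layers vanish in the limit because their relative width is of order `ε^(1 - r)`
  have hlayer : Tendsto (fun j => ENNReal.ofReal ((1 + 2 * (ρ j / ε j ^ r)) ^ d - 1) * V *
      (M + ENNReal.ofReal η)) atTop (𝓝 0) := by
    have h1 : Tendsto (fun j => (1 + 2 * (ρ j / ε j ^ r)) ^ d - 1) atTop (𝓝 0) := by
      simpa using (((hρs.const_mul 2).const_add 1).pow d).sub_const 1
    have h2 := ENNReal.tendsto_ofReal h1
    rw [ENNReal.ofReal_zero] at h2
    have h3 := ENNReal.Tendsto.mul_const h2 (b := V) (Or.inr hVtop)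
    rw [zero_mul] at h3
    have h4 := ENNReal.Tendsto.mul_const h3 (b := M + ENNReal.ofReal η)
      (Or.inr (by simp only [M]; finiteness))
    rwa [zero_mul] at h4
  filter_upwards [hρ.eventually_lt_const hτ0, hs.eventually_le_const zero_lt_one,
    hlayer.eventually_le_const (ENNReal.half_pos hδ)] with j h1 h2 h3
  have hsum : ∫⁻ x in Ω, ‖cubeEval D (ε j) (P j) x (f x)‖ₑ ^ 2 ≤
      ∑ n, ∫⁻ x in (P j).cube n, q x (phase D (ε j) (P j) n x) := by
    simp only [enorm_cubeEval_sq]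
    refine (lintegral_mono' Measure.restrict_le_self le_rfl).trans ?_
    have hm : ∀ n, Measurable fun x => q x (phase D (ε j) (P j) n x) := fun n =>
      (hqc.comp (continuous_id.prodMk (continuous_phase D (ε j) (P j) n))).measurable
    have hi : ∀ n x, ((P j).cube n).indicator
        (fun z => ‖f x (phase D (ε j) (P j) n z)‖ₑ ^ 2) x =
        ((P j).cube n).indicator (fun z => q z (phase D (ε j) (P j) n z)) x := by
      intro n x
      by_cases hx : x ∈ (P j).cube n <;> simp [hx, q]
    simp only [hi]
    rw [lintegral_finsetSum _ fun n _ => (hm n).indicator (isOpen_cube _ n).measurableSet]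
    refine (Finset.sum_congr rfl fun n _ => ?_).le
    exact lintegral_indicator (isOpen_cube _ n).measurableSet _
  have hfull : ∫⁻ x, ∫⁻ y, q x y = ∫⁻ x in Ω, ∫⁻ y, q x y := by
    refine (setLIntegral_eq_of_support_subset ?_).symm
    intro x hx
    by_contra h
    exact hx (by simp [q, hfΩ x h])
  refine hsum.trans ((sum_setLIntegral_phase_le hD.isUnit_det (hεpos j) (P j)
    (Real.rpow_pos_of_pos (hεpos j) r) hK hK0 rfl hqc.measurable
    (fun z h hh => hmod z h (hh.trans_lt h1)) hM
    (measure_mono (iUnion_cube_subset (P j) h2 hϱ))).trans ?_)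
  rw [hfull, add_assoc]
  refine add_le_add_right ((add_le_add hηV h3).trans (ENNReal.add_halves δ).le) _

/-! ### Representation of the limit functional -/

/-- A functional that is dominated by `‖J ·‖` is the inner product of `J` with a fixed vector. -/
lemma exists_eq_inner_of_le {X H : Type*} [NormedAddCommGroup X] [NormedSpace ℝ X]
    [NormedAddCommGroup H] [InnerProductSpace ℝ H] [CompleteSpace H] (F : X →L[ℝ] ℝ)
    (J : X →L[ℝ] H) (C : ℝ) (h : ∀ x, |F x| ≤ C * ‖J x‖) :
    ∃ u : H, ∀ x, F x = inner ℝ u (J x) := by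
  have hker : LinearMap.ker (J : X →ₗ[ℝ] H) ≤ LinearMap.ker (F : X →ₗ[ℝ] ℝ) := by
    intro x hx
    have h1 : J x = 0 := hx
    have h2 := h x
    rw [h1, norm_zero, mul_zero] at h2
    exact abs_nonpos_iff.mp h2
  let g : LinearMap.range (J : X →ₗ[ℝ] H) →ₗ[ℝ] ℝ :=
    ((LinearMap.ker (J : X →ₗ[ℝ] H)).liftQ (F : X →ₗ[ℝ] ℝ) hker) ∘ₗ
      ((J : X →ₗ[ℝ] H).quotKerEquivRange.symm : _ →ₗ[ℝ] _)
  have hg : ∀ x, g ⟨J x, x, rfl⟩ = F x := by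
    intro x
    have h1 : (J : X →ₗ[ℝ] H).quotKerEquivRange.symm ⟨J x, x, rfl⟩ =
        (LinearMap.ker (J : X →ₗ[ℝ] H)).mkQ x :=
      (J : X →ₗ[ℝ] H).quotKerEquivRange_symm_apply_image x _
    simp only [g, LinearMap.comp_apply, LinearEquiv.coe_coe, h1]
    rfl
  let G := g.mkContinuous C (by
    rintro ⟨_, x, rfl⟩
    have := h x
    rw [← hg] at this
    exact this)
  obtain ⟨g', hg', -⟩ := exists_extension_norm_eq _ G
  refine ⟨(InnerProductSpace.toDual ℝ H).symm g', fun x => ?_⟩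
  rw [InnerProductSpace.toDual_symm_apply, ← hg x]
  exact (hg' ⟨J x, x, rfl⟩).symm

/-- Density in `L^p(Ω; V)` of the continuous functions on the whole space that vanish off `Ω`. -/
lemma exists_continuous_eLpNorm_sub_le_of_isOpen {V : Type*} [NormedAddCommGroup V]
    [NormedSpace ℝ V] {p : ℝ≥0∞} (hp : p ≠ ∞) (hΩ : IsOpen Ω)
    {f : E d → V} (hf : MemLp f p (volume.restrict Ω)) {δ : ℝ≥0∞} (hδ : δ ≠ 0) :
    ∃ g : E d → V, eLpNorm (f - g) p (volume.restrict Ω) ≤ δ ∧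
      (Continuous g ∧ ∀ x ∉ Ω, g x = 0) := by
  refine hf.induction_dense hp _ ?_ ?_ ?_ hδ
  · intro c t ht htμ ε hε
    set μ := (volume : Measure (E d)).restrict Ω
    obtain ⟨ε', ε'pos, hε'⟩ := exists_Lp_half V μ p hε
    obtain ⟨η, ηpos, hη⟩ := exists_eLpNorm_indicator_le hp c ε'pos.ne'
    have hη_pos' : (0 : ℝ≥0∞) < η := ENNReal.coe_pos.2 ηpos
    have htΩ : μ (t ∩ Ω) ≠ ∞ := ((measure_mono Set.inter_subset_left).trans_lt htμ).ne
    -- the closed set is taken inside `t ∩ Ω`, so that its continuous cutoff can be supported in `Ω`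
    obtain ⟨s, st, -, s_closed, μs⟩ :=
      (ht.inter hΩ.measurableSet).exists_isCompact_isClosed_sdiff_lt htΩ hη_pos'.ne'
    have hst : s ⊆ t := st.trans Set.inter_subset_left
    have hsμ : μ s ≠ ∞ := ((measure_mono hst).trans_lt htμ).ne
    have μs' : μ (t \ s) ≤ η := by
      refine le_trans (measure_mono_ae ?_) μs.le
      filter_upwards [ae_restrict_mem hΩ.measurableSet] with x hx hxt
      exact ⟨⟨hxt.1, hx⟩, hxt.2⟩
    have I1 : eLpNorm ((s.indicator fun _y => c) - t.indicator fun _y => c) p μ ≤ ε' := by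
      rw [← eLpNorm_neg, neg_sub, ← Set.indicator_sdiff hst]
      exact hη _ μs'
    obtain ⟨g, g_cont, I2, -, g_support, g_mem⟩ :=
      exists_continuous_eLpNorm_sub_le_of_closed (μ := μ) hp s_closed hΩ
        (st.trans Set.inter_subset_right) hsμ c ε'pos.ne'
    refine ⟨g, ?_, g_cont, fun x hx => ?_⟩
    · convert! (hε' _ _ (g_mem.aestronglyMeasurable.sub
          (aestronglyMeasurable_const.indicator s_closed.measurableSet))
        ((aestronglyMeasurable_const.indicator s_closed.measurableSet).sub
          (aestronglyMeasurable_const.indicator ht)) I2 I1).le using 2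
      simp only [sub_add_sub_cancel]
    · by_contra h
      exact hx (g_support h)
  · rintro f g ⟨hf, hf'⟩ ⟨hg, hg'⟩
    exact ⟨hf.add hg, fun x hx => by simp [hf' x hx, hg' x hx]⟩
  · exact fun f hf => hf.1.aestronglyMeasurable

lemma dense_continuous_vanishing {V : Type*} [NormedAddCommGroup V] [NormedSpace ℝ V]
    (hΩ : IsOpen Ω) :
    Dense {x : Lp V 2 (volume.restrict Ω) | ∃ (g : E d → V) (hg : MemLp g 2 (volume.restrict Ω)),
      x = hg.toLp g ∧ Continuous g ∧ ∀ x ∉ Ω, g x = 0} := by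
  intro x
  rw [EMetric.mem_closure_iff]
  intro δ hδ
  obtain ⟨δ', hδ', hδ''⟩ := exists_between hδ
  obtain ⟨g, hg, hgc, hg0⟩ :=
    exists_continuous_eLpNorm_sub_le_of_isOpen (by simp) hΩ (Lp.memLp x) hδ'.ne'
  have hgm : MemLp g 2 (volume.restrict Ω) := by
    have h1 : MemLp ((x : E d → V) - g) 2 (volume.restrict Ω) :=
      ⟨(Lp.aestronglyMeasurable x).sub hgc.aestronglyMeasurable,
        hg.trans_lt (hδ''.trans_le le_top)⟩
    exact ((Lp.memLp x).sub h1).ae_eq (ae_of_all _ fun y => sub_sub_cancel (x y) (g y))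
  refine ⟨hgm.toLp g, ⟨g, hgm, rfl, hgc, hg0⟩, ?_⟩
  refine lt_of_le_of_lt ?_ hδ''
  rw [Lp.edist_def]
  refine le_of_eq_of_le (eLpNorm_congr_ae ?_) hg
  filter_upwards [hgm.coeFn_toLp] with y hy
  simp [hy]

lemma enorm_sq_eq_lintegral {α : Type*} [MeasurableSpace α] {ν : Measure α} (h : Lp ℝ 2 ν)
    {k : α → ℝ} (hk : h =ᵐ[ν] k) : ‖h‖ₑ ^ 2 = ∫⁻ x, ‖k x‖ₑ ^ 2 ∂ν := by
  rw [Lp.enorm_def, eLpNorm_congr_ae hk]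
  have := eLpNorm_nnreal_pow_eq_lintegral (f := k) (μ := ν) (p := 2) two_ne_zero
  simpa using this

lemma cellCLM_toLp {f : E d → C(UnitAddTorus (Fin d), ℝ)} (hf : MemLp f 2 (volume.restrict Ω)) :
    cellCLM Ω (hf.toLp f) =ᵐ[(volume.restrict Ω).prod (volume.restrict (unitCell d))]
      fun p => f p.1 (toTorus p.2) :=
  sampleCLM_toLp _ _ _ hf

lemma approxCLM_toLp (D : E d → Matrix (Fin d) (Fin d) ℝ) (ε : ℝ) (P : CubeCovering Ω s)
    {f : E d → C(UnitAddTorus (Fin d), ℝ)} (hf : MemLp f 2 (volume.restrict Ω)) :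
    approxCLM D ε P (hf.toLp f) =ᵐ[volume.restrict Ω] fun x => cubeEval D ε P x (f x) :=
  sampleCLM_toLp _ _ _ hf

lemma enorm_cellCLM_sq {f : E d → C(UnitAddTorus (Fin d), ℝ)}
    (hf : MemLp f 2 (volume.restrict Ω)) :
    ‖cellCLM Ω (hf.toLp f)‖ₑ ^ 2 = ∫⁻ x in Ω, ∫⁻ y, ‖f x y‖ₑ ^ 2 := by
  rw [enorm_sq_eq_lintegral _ (cellCLM_toLp hf), lintegral_prod]
  · refine lintegral_congr fun x => ?_
    exact (measurePreserving_toTorus (d := d)).lintegral_comp (f := fun y => ‖f x y‖ₑ ^ 2)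
      (by fun_prop)
  · have := (Lp.aestronglyMeasurable (cellCLM Ω (hf.toLp f))).congr (cellCLM_toLp hf)
    exact this.enorm.pow_const 2

lemma enorm_approxCLM_sq (D : E d → Matrix (Fin d) (Fin d) ℝ) (ε : ℝ) (P : CubeCovering Ω s)
    {f : E d → C(UnitAddTorus (Fin d), ℝ)} (hf : MemLp f 2 (volume.restrict Ω)) :
    ‖approxCLM D ε P (hf.toLp f)‖ₑ ^ 2 = ∫⁻ x in Ω, ‖cubeEval D ε P x (f x)‖ₑ ^ 2 :=
  enorm_sq_eq_lintegral _ (approxCLM_toLp D ε P hf)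

/-- A pointwise limit of the functionals `⟪v_j, 𝓛^{ε_j} ·⟫` is dominated by the norm of
`L²(Ω × Y)`, although each of them is only bounded in the norm of `L²(Ω; C_per(Y))`. -/
lemma abs_le_of_tendsto_inner_approxCLM (hΩo : IsOpen Ω) (hΩ : Bornology.IsBounded Ω)
    {D : E d → Matrix (Fin d) (Fin d) ℝ} (hD : IsTransformation Ω D) {r : ℝ} (hr0 : 0 < r)
    (hr1 : r < 1) {ε : ℕ → ℝ} (hεpos : ∀ j, 0 < ε j) (hε : Tendsto ε atTop (𝓝 0))
    (P : ∀ j, CubeCovering Ω (ε j ^ r)) {v : ℕ → Lp ℝ 2 (volume.restrict Ω)} {C : ℝ}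
    (hv : ∀ j, ‖v j‖ ≤ C)
    (F : Lp C(UnitAddTorus (Fin d), ℝ) 2 (volume.restrict Ω) →L[ℝ] ℝ)
    (hF : ∀ f, Tendsto (fun j => inner ℝ (v j) (approxCLM D (ε j) (P j) f)) atTop (𝓝 (F f)))
    (f : Lp C(UnitAddTorus (Fin d), ℝ) 2 (volume.restrict Ω)) :
    |F f| ≤ C * ‖cellCLM Ω f‖ := by
  have hC : 0 ≤ C := (norm_nonneg _).trans (hv 0)
  have hclosed : IsClosed {f | |F f| ≤ C * ‖cellCLM Ω f‖} :=
    isClosed_le (by fun_prop) (by fun_prop)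
  refine hclosed.closure_subset_iff.mpr ?_ (dense_continuous_vanishing hΩo f)
  rintro _ ⟨g, hg, rfl, hgc, hg0⟩
  have hsupp : HasCompactSupport g :=
    HasCompactSupport.of_support_subset_isCompact hΩ.isCompact_closure fun x hx =>
      subset_closure (by by_contra h; exact hx (hg0 x h))
  have hδ : ∀ δ > 0, (F (hg.toLp g)) ^ 2 ≤ C ^ 2 * (‖cellCLM Ω (hg.toLp g)‖ ^ 2 + δ) := by
    intro δ hδ
    refine le_of_tendsto ((hF (hg.toLp g)).pow 2) ?_
    filter_upwards [eventually_lintegral_cubeEval_sq_le hΩ hD hr0 hr1 hεpos hε P hgc hsupp hg0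
      (ENNReal.ofReal_pos.mpr hδ).ne'] with j hj
    rw [← enorm_cellCLM_sq hg, ← enorm_approxCLM_sq D (ε j) (P j) hg, ← ofReal_norm,
      ← ofReal_norm, ← ENNReal.ofReal_pow (norm_nonneg _), ← ENNReal.ofReal_pow (norm_nonneg _),
      ← ENNReal.ofReal_add (by positivity) hδ.le, ENNReal.ofReal_le_ofReal_iff (by positivity)]
      at hj
    have h1 := abs_real_inner_le_norm (v j) (approxCLM D (ε j) (P j) (hg.toLp g))
    calc _ ≤ (‖v j‖ * ‖approxCLM D (ε j) (P j) (hg.toLp g)‖) ^ 2 :=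
          sq_le_sq' (abs_le.mp h1).1 (abs_le.mp h1).2
      _ = ‖v j‖ ^ 2 * ‖approxCLM D (ε j) (P j) (hg.toLp g)‖ ^ 2 := mul_pow _ _ _
      _ ≤ C ^ 2 * _ := by gcongr; exact hv j
  have h0 : (F (hg.toLp g)) ^ 2 ≤ (C * ‖cellCLM Ω (hg.toLp g)‖) ^ 2 := by
    have ht : Tendsto (fun δ : ℝ => C ^ 2 * (‖cellCLM Ω (hg.toLp g)‖ ^ 2 + δ)) (𝓝[>] 0)
        (𝓝 (C ^ 2 * (‖cellCLM Ω (hg.toLp g)‖ ^ 2 + 0))) :=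
      (Continuous.tendsto (by fun_prop) 0).mono_left nhdsWithin_le_nhds
    rw [add_zero, ← mul_pow] at ht
    exact ge_of_tendsto ht (by filter_upwards [self_mem_nhdsWithin] with δ h using hδ δ h)
  exact abs_le_of_sq_le_sq h0 (by positivity)

/-- The average over `Y_x = D_x Y` is the mean over `Y` in the variable `ỹ = D_x⁻¹ y`. -/
lemma setAverage_image_unitCell {A : Matrix (Fin d) (Fin d) ℝ} (hA : IsUnit A.det) (h : E d → ℝ) :
    ⨍ y in act A '' unitCell d, h y = ∫ y in unitCell d, h (act A y) := by
  have hinj : Set.InjOn (act A) (unitCell d) :=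
    (Function.LeftInverse.injective (act_inv_act hA)).injOn
  have hdet : (act A).det ≠ 0 := by
    have h1 : act A⁻¹ ∘L act A = ContinuousLinearMap.id ℝ (E d) := by
      ext1 t; exact act_inv_act hA t
    intro h2
    have h3 := congrArg ContinuousLinearMap.det h1
    have h4 : (act A⁻¹ ∘L act A).det = (act A⁻¹).det * (act A).det := LinearMap.det_comp _ _
    rw [h4, h2, mul_zero] at h3
    simp [ContinuousLinearMap.det] at h3
  have key : ∀ k : E d → ℝ, ∫ y in act A '' unitCell d, k y =
      |(act A).det| * ∫ y in unitCell d, k (act A y) := by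
    intro k
    rw [integral_image_eq_integral_abs_det_fderiv_smul volume isClosed_unitCell.measurableSet
      (fun x _ => (act A).hasFDerivAt.hasFDerivWithinAt) hinj k]
    simp only [smul_eq_mul, integral_const_mul]
  have hvol : volume.real (act A '' unitCell d) = |(act A).det| := by
    have := key fun _ => 1
    simpa using this
  rw [setAverage_eq, hvol, key, smul_eq_mul, inv_mul_cancel_left₀ (abs_pos.mpr hdet).ne']

lemma inner_approxCLM_eq {D : E d → Matrix (Fin d) (Fin d) ℝ} (ε : ℝ) (P : CubeCovering Ω s)
    {ψ : E d → E d → ℝ} {f : E d → C(UnitAddTorus (Fin d), ℝ)}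
    (hf : MemLp f 2 (volume.restrict Ω))
    (hψ : ∀ᵐ x ∂(volume.restrict Ω), ∀ y, pullback D ψ x y = f x (toTorus y))
    (v : Lp ℝ 2 (volume.restrict Ω)) :
    inner ℝ v (approxCLM D ε P (hf.toLp f)) = ∫ x in Ω, v x * locPerApprox D ε P ψ x := by
  rw [L2.inner_def]
  refine integral_congr_ae ?_
  filter_upwards [approxCLM_toLp D ε P hf, hψ] with x h1 h2
  have h3 : locPerApprox D ε P ψ x = cubeEval D ε P x (f x) := by
    rw [cubeEval_apply, locPerApprox]
    refine Finset.sum_congr rfl fun n _ => ?_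
    by_cases hx : x ∈ P.cube n
    · rw [Set.indicator_of_mem hx, Set.indicator_of_mem hx, h2]
      rfl
    · rw [Set.indicator_of_notMem hx, Set.indicator_of_notMem hx]
  rw [h1, h3]
  simp [mul_comm]

lemma inner_cellCLM_eq {D : E d → Matrix (Fin d) (Fin d) ℝ} (hD : ∀ x, IsUnit (D x).det)
    {ψ : E d → E d → ℝ} {f : E d → C(UnitAddTorus (Fin d), ℝ)}
    (hf : MemLp f 2 (volume.restrict Ω))
    (hψ : ∀ᵐ x ∂(volume.restrict Ω), ∀ y, pullback D ψ x y = f x (toTorus y))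
    (w : Lp ℝ 2 ((volume.restrict Ω).prod (volume.restrict (unitCell d))))
    {u : E d → E d → ℝ} (hu : ∀ x y, pullback D u x y = w (x, y)) :
    inner ℝ w (cellCLM Ω (hf.toLp f)) = ∫ x in Ω, ⨍ y in cell D x, u x y * ψ x y := by
  have hae : (fun p => inner ℝ (w p) (cellCLM Ω (hf.toLp f) p))
      =ᵐ[(volume.restrict Ω).prod (volume.restrict (unitCell d))]
      fun p => w p * f p.1 (toTorus p.2) := by
    filter_upwards [cellCLM_toLp hf] with p hp
    rw [hp]
    simp [mul_comm]
  rw [L2.inner_def, integral_congr_ae hae,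
    integral_prod _ ((L2.integrable_inner w (cellCLM Ω (hf.toLp f))).congr hae)]
  refine integral_congr_ae ?_
  filter_upwards [hψ] with x hx
  rw [cell, setAverage_image_unitCell (hD x)]
  refine integral_congr_ae (ae_of_all _ fun y => ?_)
  change w (x, y) * f x (toTorus y) = pullback D u x y * pullback D ψ x y
  rw [hu, hx]

end LocallyPeriodic

theorem theorem3p2 {d : ℕ} (Ω : Set (LocallyPeriodic.E d))
    (hΩ : LocallyPeriodic.IsBoundedLipschitzDomain Ω)
    (D : LocallyPeriodic.E d → Matrix (Fin d) (Fin d) ℝ)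
    (hD : LocallyPeriodic.IsTransformation Ω D)
    (r : ℝ) (hr0 : 0 < r) (hr1 : r < 1)
    (ε : ℕ → ℝ) (hεpos : ∀ j, 0 < ε j) (hε : Tendsto ε atTop (𝓝 0))
    (P : ∀ j, LocallyPeriodic.CubeCovering Ω (ε j ^ r))
    (v : ℕ → Lp ℝ 2 (volume.restrict Ω)) (hv : ∃ C : ℝ, ∀ j, ‖v j‖ ≤ C) :
    ∃ φ : ℕ → ℕ, StrictMono φ ∧ ∃ u : LocallyPeriodic.E d → LocallyPeriodic.E d → ℝ,
      LocallyPeriodic.MemL2L2 Ω D u ∧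
      LocallyPeriodic.LtsConverges Ω D r (fun k => ε (φ k)) (fun k => P (φ k))
        (fun k => v (φ k)) u := by
  open LocallyPeriodic in
  obtain ⟨C, hC⟩ := hv
  let X := Lp C(UnitAddTorus (Fin d), ℝ) 2 (volume.restrict Ω)
  let F : ℕ → StrongDual ℝ X := fun j =>
    (innerSL ℝ (v j)) ∘L approxCLM D (ε j) (P j)
  have hFC : ∀ j, ‖F j‖ ≤ C := by
    intro j
    refine (ContinuousLinearMap.opNorm_comp_le _ _).trans ?_
    rw [innerSL_apply_norm]
    exact (mul_le_of_le_one_right (norm_nonneg (v j)) (norm_sampleCLM_le _ _ _)).trans (hC j)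
  have : Fact ((2 : ℝ≥0∞) ≠ ∞) := ⟨by simp⟩
  obtain ⟨F', -, φ, hφ, hlim⟩ := WeakDual.isSeqCompact_closedBall ℝ X (0 : StrongDual ℝ X) C
    (x := fun j => StrongDual.toWeakDual (F j)) fun j => by
      simpa using hFC j
  have hpt : ∀ f : X, Tendsto
      (fun k => inner ℝ (v (φ k)) (approxCLM D (ε (φ k)) (P (φ k)) f)) atTop (𝓝 (F' f)) :=
    fun f => ((WeakDual.eval_continuous f).tendsto F').comp hlim
  obtain ⟨w, hw⟩ := exists_eq_inner_of_le (WeakDual.toStrongDual F') (cellCLM Ω) C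
    (abs_le_of_tendsto_inner_approxCLM hΩ.isOpen hΩ.isBounded hD hr0 hr1 (fun k => hεpos (φ k))
      (hε.comp hφ.tendsto_atTop) (fun k => P (φ k)) (fun k => hC (φ k)) _ hpt)
  have hu : ∀ x y, pullback D (fun x y => w (x, act (D x)⁻¹ y)) x y = w (x, y) := by
    intro x y
    simp only [pullback]
    rw [act_inv_act (hD.isUnit_det x)]
  refine ⟨φ, hφ, fun x y => w (x, act (D x)⁻¹ y), ?_, ?_⟩
  · simp only [MemL2L2, hu]
    exact Lp.memLp w
  · rintro ψ ⟨f, hf, hψ⟩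
    have h := hpt (hf.toLp f)
    have h2 : F' (hf.toLp f) = _ := hw (hf.toLp f)
    rw [h2, inner_cellCLM_eq hD.isUnit_det hf hψ w hu] at h
    refine h.congr fun k => ?_
    exact inner_approxCLM_eq (ε (φ k)) (P (φ k)) hf hψ (v (φ k))
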